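/- Let $n=p_1\cdots p_d$ be a squarefree positive integer with $p_1,\dots,p_d$ (distinct) primes listed in some fixed order ($d=0$, $n=1$ allowed), and let $\Phi_n(x)=\sum_{k=0}^{\varphi(n)}c_kx^k$ be the $n$-th cyclotomic polynomial, $\varphi$ being Euler's function. Let $K_{p_1,\dots,p_d}$ be the complete $d$-partite simplicial complex (the simplicial join of $d$ discrete sets) whose $i$-th vertex set is the set of residues modulo $p_i$. For an integer $\ell$ let $F_\ell$ be its facet $\{\ell \bmod p_1,\dots,\ell\bmod p_d\}$, which depends only on $\ell$ modulo $n$, oriented as $[F_\ell]=[\ell\bmod p_1,\dots,\ell\bmod p_d]$. For $A\subseteq\{0,1,\dots,\varphi(n)\}$ let $K_A$ be the subcomplex of $K_{p_1,\dots,p_d}$ generated by the facets $F_\ell$ with $\ell\in A\cup\{\varphi(n)+1,\varphi(n)+2,\dots,n-1\}$. Then for any $j\ne j'$ in $\{0,\dots,\varphi(n)\}$ with $c_j,c_{j'}\neq 0$, the reduced simplicial homology of $K_{\{j,j'\}}$ satisfies $$\tilde H_{d-1}(K_{\{j,j'\}};\mathbb Z)\cong\mathbb Z .$$ Moreover, every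 nonzero $(d-1)$-cycle $z$ of $K_{\{j,j'\}}$, written as $z=\sum_{\ell \bmod n} b_\ell\,[F_\ell]$ with integer coefficients $b_\ell$ indexed by the residues $\ell$ modulo $n$, has $b_j,b_{j'}\neq0$ and $$\frac{c_j}{c_{j'}}=-\frac{b_{j'}}{b_j}.$$ In particular, $c_j$ and $c_{j'}$ have the same sign if and only if $b_j$ and $b_{j'}$ have opposite signs. -/

import Mathlib

/-! Reduced oriented simplicial homology with integer coefficients of an abstract simplicial
complex `K` on a linearly ordered vertex set `V`.

The oriented simplex `[v₀, …, vₖ]` with `v₀ < ⋯ < vₖ` is the basis vector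
`Finsupp.single {v₀, …, vₖ} 1` of `Finset V →₀ ℤ`; the empty set is the augmentation simplex in
dimension `-1`. Mathlib's complexes consist of nonempty faces only, so it is added here. -/

namespace OrientedHomology

open Finset

variable {V : Type*} [LinearOrder V]

/-- The oriented boundary
`∂[v₀, …, vₖ] = ∑ₘ (-1)ᵐ [v₀, …, v̂ₘ, …, vₖ]` for `v₀ < ⋯ < vₖ`, where `m` is the number of
vertices before the deleted one. In particular `∂[v] = [∅]` and `∂[∅] = 0`. -/
noncomputable def boundary : (Finset V →₀ ℤ) →ₗ[ℤ] (Finset V →₀ ℤ) :=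
  Finsupp.linearCombination ℤ fun s : Finset V =>
    ∑ v ∈ s, ((-1 : ℤ) ^ (s.filter (· < v)).card) • Finsupp.single (s.erase v) (1 : ℤ)

/-- `i`-chains of the augmented chain complex: chains supported on the faces with `i + 1`
vertices, the empty face included. -/
def chains (K : PreAbstractSimplicialComplex V) (i : ℤ) : Submodule ℤ (Finset V →₀ ℤ) :=
  Finsupp.supported ℤ ℤ {s : Finset V | (s = ∅ ∨ s ∈ K.faces) ∧ (s.card : ℤ) = i + 1}

/-- Reduced `i`-cycles. -/
noncomputable def cycles (K : PreAbstractSimplicialComplex V) (i : ℤ) :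
    Submodule ℤ (Finset V →₀ ℤ) :=
  chains K i ⊓ LinearMap.ker boundary

/-- Reduced `i`-boundaries. -/
noncomputable def boundaries (K : PreAbstractSimplicialComplex V) (i : ℤ) :
    Submodule ℤ (Finset V →₀ ℤ) :=
  (chains K (i + 1)).map boundary

theorem boundary_boundary (z : Finset V →₀ ℤ) : boundary (boundary z) = 0 := by
  suffices h : (boundary (V := V)) ∘ₗ boundary = 0 from LinearMap.congr_fun h z
  ext1 s
  ext1
  simp only [LinearMap.comp_apply, LinearMap.zero_apply, Finsupp.lsingle_apply]
  simp only [boundary, Finsupp.linearCombination_single, one_smul, map_sum, map_smul]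
  simp only [Finset.smul_sum, smul_smul, ← pow_add]
  rw [Finset.sum_sigma']
  refine Finset.sum_involution (fun x _ => ⟨x.2, x.1⟩) ?_ ?_ ?_ ?_
  · rintro ⟨v, w⟩ hvw
    simp only [Finset.mem_sigma, Finset.mem_erase] at hvw
    obtain ⟨hv, hne, hw⟩ := hvw
    have key : ∀ a b : V, a ∈ s → b ∈ s → a < b →
        ((s.filter (· < b)).card + ((s.erase b).filter (· < a)).card) =
        ((s.filter (· < a)).card + ((s.erase a).filter (· < b)).card) + 1 := by
      intro a b ha hb hab
      have h1 : (s.erase b).filter (· < a) = s.filter (· < a) := by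
        ext x
        simp only [Finset.mem_filter, Finset.mem_erase]
        constructor
        · tauto
        · rintro ⟨h1, h2⟩
          exact ⟨⟨(h2.trans hab).ne, h1⟩, h2⟩
      have h2 : (s.erase a).filter (· < b) = (s.filter (· < b)).erase a := by
        ext x
        simp only [Finset.mem_filter, Finset.mem_erase]
        tauto
      have h3 : a ∈ s.filter (· < b) := by simp [ha, hab]
      have h4 := Finset.card_erase_add_one h3
      rw [h1, h2]
      omega
    rw [Finset.erase_right_comm (a := w) (b := v)]
    rcases lt_or_gt_of_ne hne with h | h
    · rw [key w v hw hv h, pow_succ]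
      simp
    · rw [key v w hv hw h, pow_succ]
      simp
  · rintro ⟨v, w⟩ hvw - h
    simp only [Finset.mem_sigma, Finset.mem_erase] at hvw
    simp only [Sigma.mk.injEq] at h
    exact hvw.2.1 h.1
  · rintro ⟨v, w⟩ hvw
    simp only [Finset.mem_sigma, Finset.mem_erase] at hvw ⊢
    exact ⟨hvw.2.2, hvw.2.1.symm, hvw.1⟩
  · rintro ⟨v, w⟩ -
    rfl

theorem boundaries_le_cycles (K : PreAbstractSimplicialComplex V) (i : ℤ) :
    boundaries K i ≤ cycles K i := by
  rintro _ ⟨z, hz, rfl⟩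
  refine ⟨?_, boundary_boundary z⟩
  rw [boundary, Finsupp.linearCombination_apply]
  refine Submodule.sum_mem _ fun s hs => Submodule.smul_mem _ _ (Submodule.sum_mem _ fun v hv =>
    Submodule.smul_mem _ _ (Finsupp.single_mem_supported ℤ _ ?_))
  obtain ⟨h1, h2⟩ := (Finsupp.mem_supported ℤ z).1 hz hs
  have hc := Finset.card_erase_add_one hv
  refine ⟨?_, by omega⟩
  rcases Finset.eq_empty_or_nonempty (s.erase v) with h | h
  · exact Or.inl h
  · rcases h1 with rfl | h1
    · simp at hv
    · exact Or.inr ((K.isRelLowerSet_faces h1).2 (Finset.erase_subset v s) h)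

/-- Reduced simplicial homology `H̃ᵢ(K; ℤ)`. -/
abbrev ReducedHomology (K : PreAbstractSimplicialComplex V) (i : ℤ) : Type _ :=
  cycles K i ⧸ (boundaries K i).submoduleOf (cycles K i)

end OrientedHomology

namespace CyclotomicComplex

variable {d : ℕ}

/-- Vertices `r mod pᵢ` of `K_{p₁} * ⋯ * K_{p_d}`, as pairs `(i, r)` ordered lexicographically, so
that a simplex with at most one vertex in each part is oriented by increasing `i`. -/
abbrev Vertex (p : Fin d → ℕ) : Type := Σₗ i : Fin d, Fin (p i)

/-- The complete `d`-partite complex `K_{p₁,…,p_d} = K_{p₁} * ⋯ * K_{p_d}`: its faces are the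
nonempty vertex sets with at most one vertex in each part. -/
def multipartite (p : Fin d → ℕ) : PreAbstractSimplicialComplex (Vertex p) where
  faces := {s | s.Nonempty ∧ Set.InjOn (fun v : Vertex p => (ofLex v).1) (s : Set (Vertex p))}
  isRelLowerSet_faces := fun _ hs =>
    ⟨hs.1, fun _ hts ht => ⟨ht, hs.2.mono (Finset.coe_subset.2 hts)⟩⟩

/-- The subcomplex of `K` generated by a collection `S` of faces. -/
def generatedSubcomplex {V : Type*} (K : PreAbstractSimplicialComplex V) (S : Set (Finset V)) :
    PreAbstractSimplicialComplex V where
  faces := {s | s ∈ K.faces ∧ ∃ t ∈ S, s ⊆ t}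
  isRelLowerSet_faces := fun _ ⟨hs, t, ht, hst⟩ =>
    ⟨(K.isRelLowerSet_faces hs).1, fun _ hus hu =>
      ⟨(K.isRelLowerSet_faces hs).2 hus hu, t, ht, hus.trans hst⟩⟩

/-- The facet `F_{j mod n} = {j mod p₁, …, j mod p_d}`. -/
def facet (p : Fin d → ℕ) (j : ℕ) : Finset (Vertex p) :=
  Finset.univ.filter fun v => ((ofLex v).2 : ℕ) ≡ j [MOD p (ofLex v).1]

/-- The oriented facet `[F_j] = [j mod p₁, …, j mod p_d]`, as a chain. -/
noncomputable def orientedFacet (p : Fin d → ℕ) (j : ℕ) : Finset (Vertex p) →₀ ℤ :=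
  Finsupp.single (facet p j) 1

/-- The subcomplex `K_A` generated by the facets `F_{j mod n}` with
`j ∈ A ∪ {φ(n) + 1, …, n - 1}`, where `n = p₁ ⋯ p_d`. -/
def subcomplexK (p : Fin d → ℕ) (A : Set ℕ) : PreAbstractSimplicialComplex (Vertex p) :=
  generatedSubcomplex (multipartite p)
    (facet p '' (A ∪ Set.Ioo (Nat.totient (∏ i, p i)) (∏ i, p i)))

end CyclotomicComplex

/-! Let `n = p₁ ⋯ p_d`. A top-dimensional chain of `K_{p₁,…,p_d}` is a function `b` on `ℤ/n`, since
by the Chinese remainder theorem the facets are indexed by residues modulo `n`. The facets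
containing the ridge `F_l ∖ {l mod pᵢ}` are the `F_{l'}` with `l' ≡ l` modulo `n/pᵢ`, and in all of
them the missing vertex carries the sign `(-1)ⁱ`. So the chain is a cycle if and only if `b` sums to
zero over every coset of every subgroup of prime order of `ℤ/n` (`boundary_sum_eq_zero_iff`).

View `b` as an `n`-periodic sequence, acted on by the shift `S`. The coset sums are the terms of
`Qᵢ(S) b`, where `Qᵢ = (Xⁿ - 1) / (X ^ (n/pᵢ) - 1)`. Over `ℚ` the greatest common divisor of `Xⁿ - 1`
and the `Qᵢ` is `Φₙ`: each other cyclotomic factor `Φₘ` of `Xⁿ - 1` has `m ∣ n/pᵢ` for some `i`, and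
then it is coprime to `Qᵢ`. Hence the cycles are exactly the integer sequences with `Φₙ(S) b = 0`
(`coset_sums_eq_zero_iff`). As `Φₙ` is monic of degree `φ(n)`, such sequences correspond to arbitrary
first terms `b_0, …, b_φ(n)` subject to `∑ c_k b_k = 0`.

For a cycle of `K_{j,j'}` the terms `b_k` with `k ≤ φ(n)` and `k ≠ j, j'` vanish, so the relation
reads `c_j b_j + c_{j'} b_{j'} = 0`. It gives the ratio, and it makes `b ↦ b_j` injective on cycles
(`cyclotomic_coeff_relation`, `eq_zero_of_coeff_eq_zero`). This map is not zero, because the terms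
`c_{j'}` and `-c_j` do satisfy the relation (`exists_mem_cycles`). So the group of cycles is
isomorphic to a nonzero ideal of `ℤ`, and it is the homology group because there are no faces of
dimension `d`. -/

/-! ### Sequences annihilated by a polynomial in the shift operator -/

namespace SequenceShift

open Polynomial

/-- The shift `(S b) m = b (m + 1)` on sequences. A polynomial `q` acts on sequences as `q(S)`,
written `aeval (shift R) q`. -/
def shift (R : Type*) [CommRing R] : Module.End R (ℕ → R) :=
  LinearMap.funLeft R R Nat.succ

variable {R : Type*} [CommRing R]

theorem shift_pow_apply (k : ℕ) (b : ℕ → R) (m : ℕ) : (shift R ^ k) b m = b (m + k) := by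
  induction k generalizing m with
  | zero => simp
  | succ k ih =>
    rw [pow_succ', Module.End.mul_apply]
    change (shift R ^ k) b (m + 1) = _
    rw [ih]
    congr 1
    omega

theorem aeval_shift_apply (q : R[X]) (b : ℕ → R) (m : ℕ) :
    aeval (shift R) q b m = ∑ k ∈ Finset.range (q.natDegree + 1), q.coeff k * b (m + k) := by
  rw [aeval_eq_sum_range]
  simp [LinearMap.sum_apply, Finset.sum_apply, shift_pow_apply]

theorem aeval_shift_X_pow_sub_one (n : ℕ) (b : ℕ → R) (m : ℕ) :
    aeval (shift R) (X ^ n - 1 : R[X]) b m = b (m + n) - b m := by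
  simp [shift_pow_apply]

theorem aeval_shift_geom_sum (N r : ℕ) (b : ℕ → R) (m : ℕ) :
    aeval (shift R) (∑ t ∈ Finset.range r, (X ^ N) ^ t : R[X]) b m =
      ∑ t ∈ Finset.range r, b (m + t * N) := by
  simp [LinearMap.sum_apply, Finset.sum_apply, shift_pow_apply, ← pow_mul, mul_comm N]

theorem aeval_shift_eq_zero_of_dvd {q r : R[X]} (h : q ∣ r) {b : ℕ → R}
    (hb : aeval (shift R) q b = 0) : aeval (shift R) r b = 0 := by
  obtain ⟨s, rfl⟩ := h
  rw [mul_comm, map_mul, Module.End.mul_apply, hb, map_zero]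

theorem eq_zero_of_aeval_shift_of_isCoprime {q r : R[X]} (h : IsCoprime q r) {b : ℕ → R}
    (hq : aeval (shift R) q b = 0) (hr : aeval (shift R) r b = 0) : b = 0 :=
  (Submodule.disjoint_def.1 (disjoint_ker_aeval_of_isCoprime (shift R) h)) b hq hr

theorem aeval_shift_map_intCast (q : ℤ[X]) (b : ℕ → ℤ) (m : ℕ) :
    aeval (shift ℚ) (q.map (Int.castRingHom ℚ)) (fun k => (b k : ℚ)) m =
      ((aeval (shift ℤ) q b m : ℤ) : ℚ) := by
  rw [aeval_shift_apply, aeval_shift_apply,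
    natDegree_map_eq_of_injective (RingHom.injective_int (Int.castRingHom ℚ))]
  simp

/-- The linear recurrence whose characteristic polynomial is `q`. -/
def recurrence (q : R[X]) : LinearRecurrence R := ⟨q.natDegree, fun i => -q.coeff i⟩

theorem recurrence_isSolution_iff {q : R[X]} (hq : q.Monic) (b : ℕ → R) :
    (recurrence q).IsSolution b ↔ aeval (shift R) q b = 0 := by
  have key : ∀ m, aeval (shift R) q b m =
      (∑ i : Fin q.natDegree, q.coeff i * b (m + i)) + b (m + q.natDegree) := by
    intro m
    rw [aeval_shift_apply, Finset.sum_range_succ, hq.coeff_natDegree, one_mul,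
      Finset.sum_range fun k => q.coeff k * b (m + k)]
  constructor
  · intro h
    funext m
    have hm : b (m + q.natDegree) = ∑ i : Fin q.natDegree, -q.coeff i * b (m + i) := h m
    rw [key, hm]
    simp
  · intro h m
    have hm := congrFun h m
    rw [key] at hm
    change b (m + q.natDegree) = ∑ i : Fin q.natDegree, -q.coeff i * b (m + i)
    simp only [neg_mul, Finset.sum_neg_distrib]
    exact eq_neg_of_add_eq_zero_right hm

/-- A sequence annihilated by a monic polynomial of degree `r` can be prescribed on `{0, …, r}`,
subject to the single relation that the polynomial imposes on these terms. -/
theorem exists_aeval_shift_eq_zero {q : R[X]} (hq : q.Monic) (v : ℕ → R)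
    (hv : ∑ k ∈ Finset.range (q.natDegree + 1), q.coeff k * v k = 0) :
    ∃ b : ℕ → R, aeval (shift R) q b = 0 ∧ ∀ k ≤ q.natDegree, b k = v k := by
  let E := recurrence q
  let b := E.mkSol fun i => v i
  have hb : aeval (shift R) q b = 0 := (recurrence_isSolution_iff hq b).1 (E.is_sol_mkSol _)
  have hlt : ∀ k < q.natDegree, b k = v k := fun k hk => E.mkSol_eq_init (fun i => v i) ⟨k, hk⟩
  refine ⟨b, hb, fun k hk => ?_⟩
  rcases hk.lt_or_eq with h | rfl
  · exact hlt k h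
  · have h0 := congrFun hb 0
    rw [aeval_shift_apply] at h0
    simp only [zero_add, Pi.zero_apply] at h0
    rw [Finset.sum_range_succ, hq.coeff_natDegree, one_mul] at h0 hv
    rw [Finset.sum_congr rfl fun k hk => by rw [hlt k (Finset.mem_range.1 hk)]] at h0
    exact add_left_cancel (h0.trans hv.symm)

theorem eq_zero_of_aeval_shift_eq_zero {q : R[X]} (hq : q.Monic) {b : ℕ → R}
    (hb : aeval (shift R) q b = 0) (h0 : ∀ k < q.natDegree, b k = 0) : b = 0 := by
  have hz : aeval (shift R) q (0 : ℕ → R) = 0 := map_zero _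
  refine ((recurrence q).eq_iff_eqOn_range_order b 0 ((recurrence_isSolution_iff hq b).2 hb)
    ((recurrence_isSolution_iff hq 0).2 hz)).2 fun k hk => ?_
  exact h0 k (by simpa [recurrence] using hk)

end SequenceShift

/-! ### The cyclotomic recurrence and vanishing sums along cosets -/

namespace CyclotomicComplex

open Polynomial SequenceShift

/-- An `n`-periodic sequence is annihilated by `Φₙ` as soon as, for each other divisor `m` of `n`,
it is annihilated by some polynomial coprime to `Φₘ`: in `Xⁿ - 1 = ∏ Φₘ` every factor but `Φₙ` can
be cancelled. -/
theorem aeval_shift_cyclotomic_of_isCoprime {n : ℕ} (hn : 0 < n) {b : ℕ → ℚ}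
    (hper : aeval (shift ℚ) (X ^ n - 1 : ℚ[X]) b = 0)
    (h : ∀ m ∈ n.properDivisors, ∃ q : ℚ[X], IsCoprime (cyclotomic m ℚ) q ∧
      aeval (shift ℚ) q b = 0) :
    aeval (shift ℚ) (cyclotomic n ℚ) b = 0 := by
  have key : ∀ T : Finset ℕ, T ⊆ n.properDivisors →
      aeval (shift ℚ) ((∏ m ∈ T, cyclotomic m ℚ) * cyclotomic n ℚ) b = 0 →
      aeval (shift ℚ) (cyclotomic n ℚ) b = 0 := by
    intro T
    induction T using Finset.induction_on with
    | empty => simp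
    | insert m T hm ih =>
      intro hT hb
      rw [Finset.insert_subset_iff] at hT
      obtain ⟨q, hq, hqb⟩ := h m hT.1
      refine ih hT.2 (eq_zero_of_aeval_shift_of_isCoprime hq ?_ ?_)
      · rw [← Module.End.mul_apply, ← map_mul, ← mul_assoc,
          ← Finset.prod_insert (f := fun m => cyclotomic m ℚ) hm, hb]
      · rw [← Module.End.mul_apply, ← map_mul]
        exact aeval_shift_eq_zero_of_dvd (dvd_mul_right _ _) hqb
  refine key n.properDivisors subset_rfl ?_
  rw [← prod_cyclotomic_eq_X_pow_sub_one hn, ← Nat.insert_self_properDivisors hn.ne',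
    Finset.prod_insert (by simp), mul_comm] at hper
  exact hper

variable {d : ℕ}

/-- The cofactor `n / pᵢ` of `pᵢ` in `n = p₁ ⋯ p_d`. -/
def cofactor (p : Fin d → ℕ) (i : Fin d) : ℕ := ∏ k ∈ Finset.univ.erase i, p k

theorem cofactor_mul (p : Fin d → ℕ) (i : Fin d) : cofactor p i * p i = ∏ k, p k :=
  Finset.prod_erase_mul _ _ (Finset.mem_univ i)

theorem cofactor_pos {p : Fin d → ℕ} (hp : ∀ i, (p i).Prime) (i : Fin d) : 0 < cofactor p i :=
  Finset.prod_pos fun k _ => (hp k).pos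

theorem exists_dvd_cofactor {p : Fin d → ℕ} (hp : ∀ i, (p i).Prime) {m : ℕ}
    (hm : m ∈ (∏ i, p i).properDivisors) : ∃ i, m ∣ cofactor p i := by
  obtain ⟨⟨k, hk⟩, hlt⟩ := Nat.mem_properDivisors.1 hm
  have hk1 : k ≠ 1 := by
    rintro rfl
    omega
  obtain ⟨q, hq, hqk⟩ := Nat.exists_prime_and_dvd hk1
  obtain ⟨i, -, hi⟩ := (hq.prime.dvd_finsetProd_iff p).1
    (hqk.trans (hk ▸ dvd_mul_left k m))
  obtain rfl := (Nat.prime_dvd_prime_iff_eq hq (hp i)).1 hi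
  obtain ⟨k', rfl⟩ := hqk
  refine ⟨i, k', Nat.eq_of_mul_eq_mul_right (hp i).pos ?_⟩
  rw [cofactor_mul, hk]
  ring

/-- For an `n`-periodic sequence, the vanishing of all sums along the cosets of the subgroups of
prime order of `ℤ/n` is the recurrence with characteristic polynomial `Φₙ`. These sums are given by
the action of `(Xⁿ - 1) / (X ^ (n/pᵢ) - 1)`, a multiple of `Φₙ` which is coprime to `Φₘ` for every
`m ∣ n/pᵢ`. -/
theorem coset_sums_eq_zero_iff {p : Fin d → ℕ} (hp : ∀ i, (p i).Prime) {b : ℕ → ℤ}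
    (hper : ∀ m, b (m + ∏ i, p i) = b m) :
    (∀ i m, ∑ t ∈ Finset.range (p i), b (m + t * cofactor p i) = 0) ↔
      aeval (shift ℤ) (cyclotomic (∏ i, p i) ℤ) b = 0 := by
  set n := ∏ i, p i with hn
  have hn0 : 0 < n := Finset.prod_pos fun k _ => (hp k).pos
  have hgeom : ∀ (R : Type) [CommRing R] (i : Fin d),
      (∑ t ∈ Finset.range (p i), (X ^ cofactor p i) ^ t : R[X]) * (X ^ cofactor p i - 1) =
        X ^ n - 1 := by
    intro R _ i
    rw [geom_sum_mul, ← pow_mul, cofactor_mul]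
  constructor
  · intro h
    have hQ : aeval (shift ℚ) (cyclotomic n ℚ) (fun k => (b k : ℚ)) = 0 := by
      refine aeval_shift_cyclotomic_of_isCoprime hn0 ?_ fun m hm => ?_
      · funext m
        rw [aeval_shift_X_pow_sub_one, hper]
        simp
      · obtain ⟨i, hi⟩ := exists_dvd_cofactor hp hm
        refine ⟨∑ t ∈ Finset.range (p i), (X ^ cofactor p i) ^ t, ?_, ?_⟩
        · have hsep : (X ^ n - 1 : ℚ[X]).Separable := by
            have := separable_X_pow_sub_C (F := ℚ) (n := n) 1 (by exact_mod_cast hn0.ne')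
              one_ne_zero
            simpa using this
          rw [← hgeom ℚ i] at hsep
          refine hsep.isCoprime.symm.of_isCoprime_of_dvd_left ?_
          rw [← prod_cyclotomic_eq_X_pow_sub_one (cofactor_pos hp i)]
          exact Finset.dvd_prod_of_mem _ (Nat.mem_divisors.2 ⟨hi, (cofactor_pos hp i).ne'⟩)
        · funext m
          rw [aeval_shift_geom_sum, Pi.zero_apply]
          exact_mod_cast h i m
    funext m
    have hm := congrFun hQ m
    rw [← map_cyclotomic_int, aeval_shift_map_intCast, Pi.zero_apply] at hm
    rw [Pi.zero_apply]
    exact_mod_cast hm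
  · intro h i m
    have hdvd : cyclotomic n ℤ ∣ ∑ t ∈ Finset.range (p i), (X ^ cofactor p i) ^ t := by
      have hprop : cofactor p i ∈ n.properDivisors := by
        refine Nat.mem_properDivisors.2 ⟨⟨p i, (cofactor_mul p i).symm⟩, ?_⟩
        rw [hn, ← cofactor_mul p i]
        exact lt_mul_of_one_lt_right (cofactor_pos hp i) (hp i).one_lt
      have hX := X_pow_sub_one_mul_cyclotomic_dvd_X_pow_sub_one_of_dvd ℤ hprop
      rw [← hgeom ℤ i, mul_comm] at hX
      exact (mul_dvd_mul_iff_right (X_pow_sub_C_ne_zero (cofactor_pos hp i) (1 : ℤ))).1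
        (by simpa using hX)
    rw [← aeval_shift_geom_sum, aeval_shift_eq_zero_of_dvd hdvd h, Pi.zero_apply]

theorem periodic_of_aeval_shift_cyclotomic {n : ℕ} {b : ℕ → ℤ}
    (hb : aeval (shift ℤ) (cyclotomic n ℤ) b = 0) (m : ℕ) : b (m + n) = b m := by
  have h := congrFun (aeval_shift_eq_zero_of_dvd (cyclotomic.dvd_X_pow_sub_one n ℤ) hb) m
  rw [aeval_shift_X_pow_sub_one] at h
  exact sub_eq_zero.1 h

end CyclotomicComplex

/-! ### Facets and ridges of the multipartite complex -/

namespace CyclotomicComplex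

open OrientedHomology

variable {d : ℕ}

theorem coprime_of_squarefree_prod {p : Fin d → ℕ} (hp : ∀ i, (p i).Prime)
    (hsq : Squarefree (∏ i, p i)) {i k : Fin d} (hik : i ≠ k) : (p i).Coprime (p k) := by
  refine (Nat.coprime_primes (hp i) (hp k)).2 fun h => (hp i).one_lt.ne' ?_
  refine Nat.isUnit_iff.1 (hsq (p i) ?_)
  rw [← cofactor_mul p i]
  refine Nat.mul_dvd_mul_right ?_ (p i)
  exact h ▸ Finset.dvd_prod_of_mem p (Finset.mem_erase.2 ⟨hik.symm, Finset.mem_univ k⟩)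

theorem modEq_prod_iff {p : Fin d → ℕ} (hp : ∀ i, (p i).Prime) (hsq : Squarefree (∏ i, p i))
    (T : Finset (Fin d)) {l l' : ℕ} :
    l ≡ l' [MOD ∏ k ∈ T, p k] ↔ ∀ k ∈ T, l ≡ l' [MOD p k] := by
  simp only [Nat.modEq_iff_dvd]
  push_cast
  refine ⟨fun h k hk => (Finset.dvd_prod_of_mem (fun k => (p k : ℤ)) hk).trans h, fun h =>
    Finset.prod_dvd_of_coprime (fun i _ k _ hik => ?_) h⟩
  exact Nat.isCoprime_iff_coprime.2 (coprime_of_squarefree_prod hp hsq hik)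

/-- The vertex `l mod pᵢ` of the `i`-th part. -/
def residueVertex (p : Fin d → ℕ) [∀ i, NeZero (p i)] (l : ℕ) (i : Fin d) : Vertex p :=
  toLex ⟨i, Fin.ofNat (p i) l⟩

/-- The ridge `F_l ∖ {l mod pᵢ}`. -/
def ridge (p : Fin d → ℕ) (l : ℕ) (i : Fin d) : Finset (Vertex p) :=
  Finset.univ.filter fun v => (ofLex v).1 ≠ i ∧ ((ofLex v).2 : ℕ) ≡ l [MOD p (ofLex v).1]

theorem mem_facet {p : Fin d → ℕ} {l : ℕ} {v : Vertex p} :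
    v ∈ facet p l ↔ ((ofLex v).2 : ℕ) ≡ l [MOD p (ofLex v).1] := by
  simp [facet]

theorem mem_ridge {p : Fin d → ℕ} {l : ℕ} {i : Fin d} {v : Vertex p} :
    v ∈ ridge p l i ↔ (ofLex v).1 ≠ i ∧ ((ofLex v).2 : ℕ) ≡ l [MOD p (ofLex v).1] := by
  simp [ridge]

section

variable (p : Fin d → ℕ) [∀ i, NeZero (p i)]

theorem modEq_iff_eq_residueVertex {l : ℕ} {v : Vertex p} :
    ((ofLex v).2 : ℕ) ≡ l [MOD p (ofLex v).1] ↔ v = residueVertex p l (ofLex v).1 := by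
  obtain ⟨i, r⟩ := v
  change (r : ℕ) ≡ l [MOD p i] ↔ (⟨i, r⟩ : Σ i, Fin (p i)) = ⟨i, Fin.ofNat (p i) l⟩
  rw [Sigma.mk.injEq]
  simp [Fin.ext_iff, Nat.ModEq, Nat.mod_eq_of_lt r.2]

theorem residueVertex_modEq (l : ℕ) (i : Fin d) :
    ((ofLex (residueVertex p l i)).2 : ℕ) ≡ l [MOD p i] :=
  Nat.mod_modEq l (p i)

theorem facet_eq_image (l : ℕ) : facet p l = Finset.univ.image (residueVertex p l) := by
  ext v
  rw [mem_facet, modEq_iff_eq_residueVertex]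
  simp only [Finset.mem_image, Finset.mem_univ, true_and]
  refine ⟨fun h => ⟨_, h.symm⟩, ?_⟩
  rintro ⟨i, rfl⟩
  rfl

theorem residueVertex_injective (l : ℕ) : Function.Injective (residueVertex p l) := fun _ _ h =>
  congrArg (fun v : Vertex p => (ofLex v).1) h

theorem residueVertex_lt_iff {l : ℕ} {i k : Fin d} :
    residueVertex p l i < residueVertex p l k ↔ i < k := by
  rw [Sigma.Lex.lt_def]
  change i < k ∨ (∃ h : i = k, _) ↔ i < k
  refine ⟨?_, Or.inl⟩
  rintro (h | ⟨h, h'⟩)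
  · exact h
  · exfalso
    change i = k at h
    subst h
    exact lt_irrefl _ h'

theorem card_facet (l : ℕ) : (facet p l).card = d := by
  rw [facet_eq_image, Finset.card_image_of_injective _ (residueVertex_injective p l)]
  simp

theorem erase_residueVertex_facet (l : ℕ) (i : Fin d) :
    (facet p l).erase (residueVertex p l i) = ridge p l i := by
  ext v
  rw [Finset.mem_erase, mem_facet, mem_ridge]
  refine and_congr_left fun h => not_congr ?_
  rw [modEq_iff_eq_residueVertex] at h
  constructor
  · rintro rfl
    rfl
  · rintro rfl
    exact h

theorem card_filter_lt_residueVertex (l : ℕ) (i : Fin d) :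
    ((facet p l).filter (· < residueVertex p l i)).card = i := by
  rw [facet_eq_image, Finset.filter_image,
    Finset.card_image_of_injective _ (residueVertex_injective p l)]
  simp only [residueVertex_lt_iff]
  rw [Finset.filter_gt_eq_Iio, Fin.card_Iio]

/-- The boundary of `[F_l]`: deleting the vertex in part `i` carries the sign `(-1)ⁱ`, the same for
all `l`. -/
theorem boundary_orientedFacet (l : ℕ) :
    boundary (orientedFacet p l) =
      ∑ i : Fin d, ((-1 : ℤ) ^ (i : ℕ)) • Finsupp.single (ridge p l i) (1 : ℤ) := by
  rw [orientedFacet, boundary, Finsupp.linearCombination_single, one_smul]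
  conv_lhs => rw [Finset.sum_congr (facet_eq_image p l) fun _ _ => rfl]
  rw [Finset.sum_image fun i _ k _ h => residueVertex_injective p l h]
  refine Finset.sum_congr rfl fun i _ => ?_
  rw [card_filter_lt_residueVertex, ← erase_residueVertex_facet]
  congr!

variable {p}

theorem facet_eq_iff (hp : ∀ i, (p i).Prime) (hsq : Squarefree (∏ i, p i)) {l l' : ℕ} :
    facet p l = facet p l' ↔ l ≡ l' [MOD ∏ i, p i] := by
  rw [modEq_prod_iff hp hsq]
  constructor
  · intro h k _
    have hk : residueVertex p l k ∈ facet p l' := h ▸ mem_facet.2 (residueVertex_modEq p l k)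
    exact (residueVertex_modEq p l k).symm.trans (mem_facet.1 hk)
  · intro h
    ext v
    rw [mem_facet, mem_facet]
    exact ⟨fun hv => hv.trans (h _ (Finset.mem_univ _)),
      fun hv => hv.trans (h _ (Finset.mem_univ _)).symm⟩

theorem ridge_eq_iff (hp : ∀ i, (p i).Prime) (hsq : Squarefree (∏ i, p i)) {l l' : ℕ}
    {i i' : Fin d} : ridge p l i = ridge p l' i' ↔ i = i' ∧ l ≡ l' [MOD cofactor p i] := by
  rw [cofactor, modEq_prod_iff hp hsq]
  constructor
  · intro h
    have hii : i = i' := by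
      by_contra hne
      have hmem : residueVertex p l i' ∈ ridge p l' i' :=
        h ▸ mem_ridge.2 ⟨fun h' => hne h'.symm, residueVertex_modEq p l i'⟩
      exact (mem_ridge.1 hmem).1 rfl
    refine ⟨hii, fun k hk => ?_⟩
    have hmem : residueVertex p l k ∈ ridge p l' i' :=
      h ▸ mem_ridge.2 ⟨(Finset.mem_erase.1 hk).1, residueVertex_modEq p l k⟩
    exact (residueVertex_modEq p l k).symm.trans (mem_ridge.1 hmem).2
  · rintro ⟨rfl, h⟩
    ext v
    rw [mem_ridge, mem_ridge]
    refine and_congr_right fun hv => ?_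
    have hk := h _ (Finset.mem_erase.2 ⟨hv, Finset.mem_univ _⟩)
    exact ⟨fun h' => h'.trans hk, fun h' => h'.trans hk.symm⟩

end

/-! ### Cycles of the multipartite complex -/

theorem sum_range_filter_modEq {M : Type*} [AddCommGroup M] {N r : ℕ} (hN : 0 < N) {b : ℕ → M}
    (hper : ∀ m, b (m + N * r) = b m) (l : ℕ) :
    ∑ l' ∈ (Finset.range (N * r)).filter (· ≡ l [MOD N]), b l' =
      ∑ t ∈ Finset.range r, b (l + t * N) := by
  -- The right-hand side is `N`-periodic in `l`, so `l` may be replaced by `l % N`.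
  have hg : Function.Periodic (fun l => ∑ t ∈ Finset.range r, b (l + t * N)) N := by
    intro l
    have h := (Finset.sum_range_succ (fun t => b (l + t * N)) r).symm.trans
      (Finset.sum_range_succ' (fun t => b (l + t * N)) r)
    rw [mul_comm r N, hper, zero_mul, add_zero] at h
    refine Eq.trans (Finset.sum_congr rfl fun t _ => ?_) (add_right_cancel h).symm
    congr 1
    ring
  refine Eq.trans ?_ (hg.map_mod_nat l)
  have hlt := Nat.mod_lt l hN
  refine Finset.sum_nbij' (fun l' => l' / N) (fun t => l % N + t * N) ?_ ?_ ?_ ?_ ?_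
  · intro l' hl'
    simp only [Finset.mem_filter, Finset.mem_range] at hl' ⊢
    exact Nat.div_lt_of_lt_mul hl'.1
  · intro t ht
    simp only [Finset.mem_filter, Finset.mem_range] at ht ⊢
    constructor
    · calc l % N + t * N < N + t * N := by omega
        _ = N * (t + 1) := by ring
        _ ≤ N * r := Nat.mul_le_mul_left N ht
    · simp [Nat.ModEq]
  · intro l' hl'
    have h : l' % N = l % N := (Finset.mem_filter.1 hl').2
    rw [← h, mul_comm]
    exact Nat.mod_add_div l' N
  · intro t _
    rw [Nat.add_mul_div_right _ _ hN, Nat.div_eq_of_lt hlt, zero_add]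
  · intro l' hl'
    have h : l' % N = l % N := (Finset.mem_filter.1 hl').2
    change b l' = b (l % N + l' / N * N)
    rw [← h, mul_comm, Nat.mod_add_div]

/-- A combination `∑ b_l [F_l]` is a cycle if and only if `b` sums to zero over each coset of each
subgroup of prime order of `ℤ/n`: the facets containing a ridge in the parts other than `i` form
one coset of the subgroup of order `pᵢ`. -/
theorem boundary_sum_eq_zero_iff {p : Fin d → ℕ} (hp : ∀ i, (p i).Prime)
    (hsq : Squarefree (∏ i, p i)) {b : ℕ → ℤ} (hper : ∀ m, b (m + ∏ i, p i) = b m) :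
    boundary (∑ l ∈ Finset.range (∏ i, p i), b l • orientedFacet p l) = 0 ↔
      ∀ i m, ∑ t ∈ Finset.range (p i), b (m + t * cofactor p i) = 0 := by
  have : ∀ i, NeZero (p i) := fun i => ⟨(hp i).ne_zero⟩
  have hcoset : ∀ i m, ∑ l ∈ Finset.range (∏ i, p i),
      (if ridge p l i = ridge p m i then b l else 0) =
        ∑ t ∈ Finset.range (p i), b (m + t * cofactor p i) := by
    intro i m
    simp only [ridge_eq_iff hp hsq, true_and]
    rw [← Finset.sum_filter, ← cofactor_mul p i]
    exact sum_range_filter_modEq (cofactor_pos hp i) (by rwa [cofactor_mul]) m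
  have heval : ∀ s, boundary (∑ l ∈ Finset.range (∏ i, p i), b l • orientedFacet p l) s =
      ∑ i : Fin d, (-1 : ℤ) ^ (i : ℕ) * ∑ l ∈ Finset.range (∏ i, p i),
        (if ridge p l i = s then b l else 0) := by
    intro s
    simp only [map_sum, map_smul, boundary_orientedFacet, Finset.smul_sum, Finsupp.finsetSum_apply,
      Finsupp.smul_apply, Finsupp.single_apply, smul_eq_mul, Finset.mul_sum]
    rw [Finset.sum_comm]
    refine Finset.sum_congr rfl fun i _ => Finset.sum_congr rfl fun l _ => ?_
    split_ifs <;> ring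
  constructor
  · intro h i m
    have hi := heval (ridge p m i)
    rw [h, Finset.sum_eq_single i, hcoset] at hi
    · exact (mul_eq_zero.1 hi.symm).resolve_left (pow_ne_zero _ (by norm_num))
    · intro k _ hk
      rw [Finset.sum_eq_zero, mul_zero]
      intro l _
      exact if_neg fun h' => hk ((ridge_eq_iff hp hsq).1 h').1
    · simp
  · intro h
    ext s
    rw [heval, Finsupp.zero_apply]
    refine Finset.sum_eq_zero fun i _ => ?_
    by_cases hs : ∃ m, ridge p m i = s
    · obtain ⟨m, rfl⟩ := hs
      rw [hcoset, h, mul_zero]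
    · rw [Finset.sum_eq_zero, mul_zero]
      exact fun l _ => if_neg fun hl => hs ⟨l, hl⟩

end CyclotomicComplex

/-! ### Top-dimensional chains and cycles of the subcomplexes -/

namespace CyclotomicComplex

open OrientedHomology SequenceShift

variable {d : ℕ} {p : Fin d → ℕ}

theorem injOn_part_facet [∀ i, NeZero (p i)] (l : ℕ) :
    Set.InjOn (fun v : Vertex p => (ofLex v).1) (facet p l : Set (Vertex p)) := by
  intro v hv w hw h
  have hv' := (modEq_iff_eq_residueVertex p).1 (mem_facet.1 (Finset.mem_coe.1 hv))
  have hw' := (modEq_iff_eq_residueVertex p).1 (mem_facet.1 (Finset.mem_coe.1 hw))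
  rw [hv', hw']
  exact congrArg _ h

/-- The `(d - 1)`-chains of `K_A` are the combinations of its generating facets. For `d = 0` these
facets are all empty, and nonemptiness of `A` provides one. -/
theorem mem_chains_iff [∀ i, NeZero (p i)] {A : Set ℕ} (hA : A.Nonempty)
    {z : Finset (Vertex p) →₀ ℤ} :
    z ∈ chains (subcomplexK p A) ((d : ℤ) - 1) ↔ ∀ s, z s ≠ 0 →
      ∃ l ∈ A ∪ Set.Ioo (Nat.totient (∏ i, p i)) (∏ i, p i), facet p l = s := by
  rw [chains, Finsupp.mem_supported]
  refine forall_congr' fun s => ?_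
  rw [Finset.mem_coe, Finsupp.mem_support_iff]
  refine imp_congr_right fun _ => ?_
  constructor
  · rintro ⟨hs | hs, hcard⟩
    · obtain ⟨l, hl⟩ := hA
      refine ⟨l, Or.inl hl, ?_⟩
      subst hs
      have hd := card_facet p l
      rw [Finset.card_empty] at hcard
      exact Finset.card_eq_zero.1 (by omega)
    · obtain ⟨-, _, ⟨l, hl, rfl⟩, hsl⟩ := hs
      refine ⟨l, hl, (Finset.eq_of_subset_of_card_le hsl ?_).symm⟩
      rw [card_facet]
      omega
  · rintro ⟨l, hl, rfl⟩
    refine ⟨?_, by rw [card_facet]; omega⟩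
    rcases (facet p l).eq_empty_or_nonempty with h | h
    · exact Or.inl h
    · exact Or.inr ⟨⟨h, injOn_part_facet l⟩, _, ⟨l, hl, rfl⟩, subset_rfl⟩

theorem boundaries_top_eq_bot (A : Set ℕ) :
    boundaries (subcomplexK p A) ((d : ℤ) - 1) = ⊥ := by
  rw [eq_bot_iff]
  rintro _ ⟨z, hz, rfl⟩
  suffices h : z = 0 by simp [h]
  by_contra hne
  obtain ⟨s, hs⟩ := Finsupp.ne_iff.1 hne
  obtain ⟨h1, h2⟩ := (Finsupp.mem_supported ℤ z).1 hz (Finsupp.mem_support_iff.2 hs)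
  rcases h1 with rfl | ⟨h1, -⟩
  · rw [Finset.card_empty] at h2
    omega
  · have hle := Finset.card_le_card_of_injOn _ (fun _ _ => Finset.mem_univ _) h1.2
    rw [Finset.card_univ, Fintype.card_fin] at hle
    omega

theorem coeff_facet_periodic (hp : ∀ i, (p i).Prime) (hsq : Squarefree (∏ i, p i))
    (z : Finset (Vertex p) →₀ ℤ) (m : ℕ) :
    z (facet p (m + ∏ i, p i)) = z (facet p m) := by
  have : ∀ i, NeZero (p i) := fun i => ⟨(hp i).ne_zero⟩
  rw [(facet_eq_iff hp hsq (l := m + ∏ i, p i) (l' := m)).2 (by simp [Nat.ModEq])]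

theorem sum_orientedFacet_apply_facet (hp : ∀ i, (p i).Prime) (hsq : Squarefree (∏ i, p i))
    {b : ℕ → ℤ} (hper : ∀ m, b (m + ∏ i, p i) = b m) (m : ℕ) :
    (∑ l ∈ Finset.range (∏ i, p i), b l • orientedFacet p l) (facet p m) = b m := by
  have : ∀ i, NeZero (p i) := fun i => ⟨(hp i).ne_zero⟩
  have hn : 0 < ∏ i, p i := Finset.prod_pos fun k _ => (hp k).pos
  have hmod : b (m % ∏ i, p i) = b m := Function.Periodic.map_mod_nat hper m
  simp only [orientedFacet, Finsupp.finsetSum_apply, Finsupp.smul_apply, Finsupp.single_apply,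
    facet_eq_iff hp hsq, smul_eq_mul, mul_ite, mul_one, mul_zero]
  rw [Finset.sum_eq_single (m % ∏ i, p i), if_pos (Nat.mod_modEq _ _), hmod]
  · intro l hl hne
    refine if_neg fun h => hne ?_
    rw [← h, Nat.mod_eq_of_lt (Finset.mem_range.1 hl)]
  · exact fun h => absurd (Finset.mem_range.2 (Nat.mod_lt m hn)) h

theorem sum_orientedFacet_apply_eq_zero (b : ℕ → ℤ) {s : Finset (Vertex p)}
    (hs : ∀ m, facet p m ≠ s) :
    (∑ l ∈ Finset.range (∏ i, p i), b l • orientedFacet p l) s = 0 := by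
  simp [orientedFacet, Finsupp.finsetSum_apply, hs]

theorem eq_sum_orientedFacet (hp : ∀ i, (p i).Prime) (hsq : Squarefree (∏ i, p i))
    {A : Set ℕ} (hA : A.Nonempty) {z : Finset (Vertex p) →₀ ℤ}
    (hz : z ∈ chains (subcomplexK p A) ((d : ℤ) - 1)) :
    z = ∑ l ∈ Finset.range (∏ i, p i), z (facet p l) • orientedFacet p l := by
  have : ∀ i, NeZero (p i) := fun i => ⟨(hp i).ne_zero⟩
  ext s
  by_cases hs : ∃ m, facet p m = s
  · obtain ⟨m, rfl⟩ := hs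
    exact (sum_orientedFacet_apply_facet hp hsq (b := fun l => z (facet p l))
      (coeff_facet_periodic hp hsq z) m).symm
  · rw [sum_orientedFacet_apply_eq_zero _ fun m hm => hs ⟨m, hm⟩]
    by_contra h
    obtain ⟨l, -, hl⟩ := (mem_chains_iff hA).1 hz s h
    exact hs ⟨l, hl⟩

/-- The coefficients of a top-dimensional cycle satisfy the recurrence with characteristic
polynomial `Φₙ`. -/
theorem aeval_shift_cyclotomic_of_mem_cycles (hp : ∀ i, (p i).Prime) (hsq : Squarefree (∏ i, p i))
    {A : Set ℕ} (hA : A.Nonempty)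
    {z : Finset (Vertex p) →₀ ℤ} (hz : z ∈ cycles (subcomplexK p A) ((d : ℤ) - 1)) :
    Polynomial.aeval (shift ℤ) (Polynomial.cyclotomic (∏ i, p i) ℤ) (fun l => z (facet p l)) = 0 :=
  (coset_sums_eq_zero_iff hp (coeff_facet_periodic hp hsq z)).1
    ((boundary_sum_eq_zero_iff hp hsq (coeff_facet_periodic hp hsq z)).1
      (by rw [← eq_sum_orientedFacet hp hsq hA hz.1]; exact hz.2))

theorem coeff_facet_eq_zero (hp : ∀ i, (p i).Prime) (hsq : Squarefree (∏ i, p i))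
    {j j' : ℕ} (hne : j ≠ j')
    (hj : j ≤ (∏ i, p i).totient) (hj' : j' ≤ (∏ i, p i).totient)
    {z : Finset (Vertex p) →₀ ℤ}
    (hz : z ∈ chains (subcomplexK p {j, j'}) ((d : ℤ) - 1)) {k : ℕ}
    (hk : k ≤ (∏ i, p i).totient) (hkj : k ≠ j) (hkj' : k ≠ j') : z (facet p k) = 0 := by
  have : ∀ i, NeZero (p i) := fun i => ⟨(hp i).ne_zero⟩
  have hn : 0 < ∏ i, p i := Finset.prod_pos fun k _ => (hp k).pos
  by_contra h
  obtain ⟨l, hl, hlk⟩ := (mem_chains_iff ⟨j, Or.inl rfl⟩).1 hz _ h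
  rw [facet_eq_iff hp hsq] at hlk
  generalize (∏ i, p i) = n at *
  rcases Nat.eq_or_lt_of_le (Nat.succ_le_of_lt hn) with h1 | h1
  · -- For `n = 1` the exponents `j` and `j'` already exhaust `{0, 1}`.
    obtain rfl : n = 1 := h1.symm
    rw [Nat.totient_one] at hk hj hj'
    omega
  · have ht := Nat.totient_lt n h1
    have hln : l < n := by
      rcases hl with (rfl | rfl) | hl
      · omega
      · omega
      · exact hl.2
    obtain rfl := hlk.eq_of_lt_of_lt hln (by omega)
    rcases hl with (rfl | rfl) | hl
    · exact hkj rfl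
    · exact hkj' rfl
    · exact absurd hl.1 (by omega)

/-- The term of index `0` of the recurrence: only `j` and `j'` contribute, as the other
coefficients of the cycle in degrees `0, …, φ(n)` vanish. -/
theorem cyclotomic_coeff_relation (hp : ∀ i, (p i).Prime) (hsq : Squarefree (∏ i, p i))
    {j j' : ℕ} (hne : j ≠ j')
    (hj : j ≤ (∏ i, p i).totient) (hj' : j' ≤ (∏ i, p i).totient)
    {z : Finset (Vertex p) →₀ ℤ}
    (hz : z ∈ cycles (subcomplexK p {j, j'}) ((d : ℤ) - 1)) :
    (Polynomial.cyclotomic (∏ i, p i) ℤ).coeff j * z (facet p j) +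
      (Polynomial.cyclotomic (∏ i, p i) ℤ).coeff j' * z (facet p j') = 0 := by
  have h := congrFun (aeval_shift_cyclotomic_of_mem_cycles hp hsq ⟨j, Or.inl rfl⟩ hz) 0
  rw [aeval_shift_apply, Polynomial.natDegree_cyclotomic] at h
  simp only [zero_add, Pi.zero_apply] at h
  rwa [Finset.sum_eq_add_of_mem j j' (Finset.mem_range.2 (by omega))
    (Finset.mem_range.2 (by omega)) hne] at h
  intro k hk hkj
  rw [coeff_facet_eq_zero hp hsq hne hj hj' hz.1 (by simpa [Nat.lt_succ_iff] using hk) hkj.1 hkj.2,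
    mul_zero]

/-- A cycle with vanishing coefficients at `F_j` and `F_{j'}` vanishes, since a solution of the
recurrence is determined by its first `φ(n)` terms. -/
theorem eq_zero_of_coeff_eq_zero (hp : ∀ i, (p i).Prime) (hsq : Squarefree (∏ i, p i))
    {j j' : ℕ} (hne : j ≠ j')
    (hj : j ≤ (∏ i, p i).totient) (hj' : j' ≤ (∏ i, p i).totient)
    {z : Finset (Vertex p) →₀ ℤ}
    (hz : z ∈ cycles (subcomplexK p {j, j'}) ((d : ℤ) - 1)) (hzj : z (facet p j) = 0)
    (hzj' : z (facet p j') = 0) : z = 0 := by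
  have hA : ({j, j'} : Set ℕ).Nonempty := ⟨j, Or.inl rfl⟩
  have hb := eq_zero_of_aeval_shift_eq_zero (Polynomial.cyclotomic.monic (∏ i, p i) ℤ)
    (aeval_shift_cyclotomic_of_mem_cycles hp hsq hA hz) fun k hk => ?_
  · rw [eq_sum_orientedFacet hp hsq hA hz.1]
    exact Finset.sum_eq_zero fun l _ => by
      rw [show z (facet p l) = 0 from congrFun hb l, zero_smul]
  · rw [Polynomial.natDegree_cyclotomic] at hk
    by_cases hkj : k = j
    · rwa [hkj]
    by_cases hkj' : k = j'
    · rwa [hkj']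
    exact coeff_facet_eq_zero hp hsq hne hj hj' hz.1 hk.le hkj hkj'

/-- The values `c_{j'}` at `j`, `-c_j` at `j'` and `0` elsewhere in `{0, …, φ(n)}` satisfy the
relation imposed by `Φₙ`, so they extend to a solution of the recurrence, that is, to a cycle. -/
theorem exists_mem_cycles (hp : ∀ i, (p i).Prime) (hsq : Squarefree (∏ i, p i))
    {j j' : ℕ} (hne : j ≠ j')
    (hj : j ≤ (∏ i, p i).totient) (hj' : j' ≤ (∏ i, p i).totient) :
    ∃ z ∈ cycles (subcomplexK p {j, j'}) ((d : ℤ) - 1),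
      z (facet p j) = (Polynomial.cyclotomic (∏ i, p i) ℤ).coeff j' := by
  have : ∀ i, NeZero (p i) := fun i => ⟨(hp i).ne_zero⟩
  set Φ := Polynomial.cyclotomic (∏ i, p i) ℤ
  have hdeg : Φ.natDegree = (∏ i, p i).totient := Polynomial.natDegree_cyclotomic _ ℤ
  let v : ℕ → ℤ := fun k => if k = j then Φ.coeff j' else if k = j' then -Φ.coeff j else 0
  obtain ⟨b, hb, hbv⟩ := exists_aeval_shift_eq_zero (q := Φ) (Polynomial.cyclotomic.monic _ ℤ) v (by
    rw [Finset.sum_eq_add_of_mem j j' (Finset.mem_range.2 (by omega))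
      (Finset.mem_range.2 (by omega)) hne]
    · simp only [v, if_true, if_neg hne.symm]
      ring
    · intro k _ hk
      simp [v, hk.1, hk.2])
  have hper := periodic_of_aeval_shift_cyclotomic hb
  have happly := sum_orientedFacet_apply_facet hp hsq hper
  refine ⟨∑ l ∈ Finset.range (∏ i, p i), b l • orientedFacet p l, ⟨?_, ?_⟩, ?_⟩
  · refine (mem_chains_iff ⟨j, Or.inl rfl⟩).2 fun s hs => ?_
    obtain ⟨l, hl, hls⟩ : ∃ l ∈ Finset.range (∏ i, p i),
        (b l • orientedFacet p l : Finset (Vertex p) →₀ ℤ) s ≠ 0 := by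
      rw [Finsupp.finsetSum_apply] at hs
      exact Finset.exists_ne_zero_of_sum_ne_zero hs
    have hbl : b l ≠ 0 := fun h => hls (by simp [h])
    refine ⟨l, ?_, ?_⟩
    · by_contra hcon
      simp only [Set.mem_union, Set.mem_insert_iff, Set.mem_singleton_iff, Set.mem_Ioo, not_or,
        not_and, not_lt] at hcon
      have hle : l ≤ (∏ i, p i).totient := by
        by_contra hlt
        exact absurd (Finset.mem_range.1 hl) (not_lt.2 (hcon.2 (not_le.1 hlt)))
      refine hbl ((hbv l (hdeg ▸ hle)).trans ?_)
      simp [v, hcon.1.1, hcon.1.2]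
    · by_contra h
      exact hls (by simp [orientedFacet, h])
  · exact (boundary_sum_eq_zero_iff hp hsq hper).2 ((coset_sums_eq_zero_iff hp hper).2 hb)
  · rw [happly, hbv j (hdeg ▸ hj)]
    simp [v]

end CyclotomicComplex

/-! ### The homology group and the coefficient ratio -/

theorem nonempty_linearEquiv_int_of_injective {M : Type*} [AddCommGroup M] (f : M →ₗ[ℤ] ℤ)
    (hf : Function.Injective f) {x : M} (hx : f x ≠ 0) : Nonempty (M ≃ₗ[ℤ] ℤ) := by
  obtain ⟨g, hg⟩ := (inferInstance : (LinearMap.range f).IsPrincipal)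
  have hg0 : g ≠ 0 := by
    rintro rfl
    have hmem : f x ∈ LinearMap.range f := ⟨x, rfl⟩
    rw [hg, Submodule.span_zero_singleton] at hmem
    exact hx hmem
  exact ⟨(LinearEquiv.ofInjective f hf).trans ((LinearEquiv.ofEq _ _ hg).trans
    (LinearEquiv.toSpanNonzeroSingleton ℤ ℤ g hg0).symm)⟩

theorem sign_eq_iff_of_mul_add_mul_eq_zero {a a' b b' : ℤ} (ha' : a' ≠ 0)
    (hb : b ≠ 0) (h : a * b + a' * b' = 0) :
    a.sign = a'.sign ↔ b.sign = -b'.sign := by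
  have hs : a.sign * b.sign = -(a'.sign * b'.sign) := by
    rw [← Int.sign_mul, ← Int.sign_mul, ← Int.sign_neg, eq_neg_of_add_eq_zero_left h]
  constructor
  · intro h1
    rw [h1, ← mul_neg] at hs
    exact mul_left_cancel₀ (fun h0 => ha' (Int.sign_eq_zero_iff_zero.1 h0)) hs
  · intro h1
    have hb' : b'.sign ≠ 0 := by
      intro h0
      rw [h0, neg_zero] at h1
      exact hb (Int.sign_eq_zero_iff_zero.1 h1)
    rw [h1, mul_neg, neg_inj] at hs
    exact mul_right_cancel₀ hb' hs

theorem theorem2 {d : ℕ} (p : Fin d → ℕ) (hp : ∀ i, (p i).Prime)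
    (n : ℕ) (hn : n = ∏ i, p i) (hsq : Squarefree n)
    (c : ℕ → ℤ) (hc : ∀ k, c k = (Polynomial.cyclotomic n ℤ).coeff k)
    (j j' : ℕ) (hjj' : j ≠ j') (hj : c j ≠ 0) (hj' : c j' ≠ 0) :
    Nonempty (OrientedHomology.ReducedHomology (CyclotomicComplex.subcomplexK p {j, j'}) ((d : ℤ) - 1) ≃ₗ[ℤ] ℤ) ∧
    ∀ z ∈ OrientedHomology.cycles (CyclotomicComplex.subcomplexK p {j, j'}) ((d : ℤ) - 1), z ≠ 0 →
      ∃ b : ℕ → ℤ, (∀ l, b l = z (CyclotomicComplex.facet p l)) ∧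
        z = ∑ l ∈ Finset.range n, b l • CyclotomicComplex.orientedFacet p l ∧
        b j ≠ 0 ∧ b j' ≠ 0 ∧
        (c j : ℚ) / (c j' : ℚ) = -((b j' : ℚ) / (b j : ℚ)) ∧
        (Int.sign (c j) = Int.sign (c j') ↔ Int.sign (b j) = -Int.sign (b j')) := by
  subst hn
  have hle : ∀ k, c k ≠ 0 → k ≤ (∏ i, p i).totient := by
    intro k hk
    rw [hc] at hk
    exact (Polynomial.le_natDegree_of_ne_zero hk).trans_eq (Polynomial.natDegree_cyclotomic _ ℤ)
  have hrel : ∀ z ∈ OrientedHomology.cycles (CyclotomicComplex.subcomplexK p {j, j'})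
      ((d : ℤ) - 1), c j * z (CyclotomicComplex.facet p j) +
        c j' * z (CyclotomicComplex.facet p j') = 0 := by
    intro z hz
    rw [hc, hc]
    exact CyclotomicComplex.cyclotomic_coeff_relation hp hsq hjj' (hle j hj) (hle j' hj') hz
  have hzero : ∀ z ∈ OrientedHomology.cycles (CyclotomicComplex.subcomplexK p {j, j'})
      ((d : ℤ) - 1), z (CyclotomicComplex.facet p j) = 0 → z = 0 := by
    intro z hz hzj
    have h := hrel z hz
    rw [hzj, mul_zero, zero_add] at h
    exact CyclotomicComplex.eq_zero_of_coeff_eq_zero hp hsq hjj' (hle j hj) (hle j' hj') hz hzj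
      ((mul_eq_zero.1 h).resolve_left hj')
  constructor
  · let f : OrientedHomology.cycles (CyclotomicComplex.subcomplexK p {j, j'}) ((d : ℤ) - 1)
        →ₗ[ℤ] ℤ := Finsupp.lapply (CyclotomicComplex.facet p j) ∘ₗ Submodule.subtype _
    have hf : Function.Injective f := by
      rw [injective_iff_map_eq_zero]
      exact fun z hz => Subtype.ext (hzero z z.2 hz)
    obtain ⟨z, hz, hzj⟩ := CyclotomicComplex.exists_mem_cycles hp hsq hjj' (hle j hj) (hle j' hj')
    have hx : f ⟨z, hz⟩ ≠ 0 := by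
      change z (CyclotomicComplex.facet p j) ≠ 0
      rwa [hzj, ← hc]
    obtain ⟨e⟩ := nonempty_linearEquiv_int_of_injective f hf hx
    refine ⟨(Submodule.quotEquivOfEqBot _ ?_).trans e⟩
    rw [CyclotomicComplex.boundaries_top_eq_bot, Submodule.submoduleOf, Submodule.comap_bot,
      Submodule.ker_subtype]
  · intro z hz hz0
    have h := hrel z hz
    have hbj : z (CyclotomicComplex.facet p j) ≠ 0 := fun h0 => hz0 (hzero z hz h0)
    have hbj' : z (CyclotomicComplex.facet p j') ≠ 0 := by
      intro h0
      rw [h0, mul_zero, add_zero] at h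
      exact (mul_ne_zero hj hbj) h
    refine ⟨fun l => z (CyclotomicComplex.facet p l), fun _ => rfl,
      CyclotomicComplex.eq_sum_orientedFacet hp hsq ⟨j, Or.inl rfl⟩ hz.1, hbj, hbj', ?_,
      sign_eq_iff_of_mul_add_mul_eq_zero hj' hbj h⟩
    have hq : (c j : ℚ) * z (CyclotomicComplex.facet p j) +
        c j' * z (CyclotomicComplex.facet p j') = 0 := by exact_mod_cast h
    have h1 : (c j' : ℚ) ≠ 0 := by exact_mod_cast hj'
    have h2 : ((z (CyclotomicComplex.facet p j) : ℤ) : ℚ) ≠ 0 := by exact_mod_cast hbj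
    rw [← neg_div, div_eq_div_iff h1 h2]
    linear_combination hq
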